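/- Let $\mu,\nu$ be Borel probability measures on $\mathbb{R}$ with finite first moments. For a finite measure $\eta$ on $\mathbb{R}$ let $\ell_\eta=\inf\operatorname{supp}(\eta)$, $r_\eta=\sup\operatorname{supp}(\eta)$ (in $[-\infty,\infty]$) and $C_\eta(k)=\int(x-k)^+\,\eta(dx)$. Write $\eta\le\chi$ if $\eta(A)\le\chi(A)$ for all Borel $A$, and $\eta\leq_{cd}\chi$ if $\int\varphi\,d\eta\le\int\varphi\,d\chi$ for all convex non-increasing $\varphi:\mathbb{R}\to\mathbb{R}$. The shadow $S^\nu(\eta)$ is the smallest element with respect to $\leq_{cd}$ of $\{\theta:\eta\leq_{cd}\theta\leq\nu\}$. Suppose that $\mu\leq_{cd}\nu$ and that the Dispersion Assumption holds: $\mu,\nu$ have densities $f_\mu,f_\nu$ with $f_\mu>0$ on $(\ell_\mu,r_\mu)$, $f_\nu>0$ on $(\ell_\nu,r_\nu)$, $\ell_\nu\le\ell_\mu<r_\mu\le r_\nu$, and there are $\ell_\mu<\underline m<\overline m<r_\mu$ such that $f_\mu>f_\nu$ on $(\underline m,\overline m)$, $f_\nu>f_\mu$ on $(\ell_\nu,\underline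 m)\cup(\overline m,r_\nu)$, and $f_\mu=f_\nu$ on $\{\underline m,\overline m\}$. Let $\hat{\mathbb P}$ be the decreasing supermartingale coupling of $\mu$ and $\nu$, i.e. the law of a pair $(X,Y)$ on $\mathbb{R}^2$ with $X\sim\mu$, $Y\sim\nu$, $\mathbb{E}[Y|X]\le X$ a.s., such that for every $x\in\mathbb{R}$ the second marginal of $\hat{\mathbb P}|_{[x,\infty)\times\mathbb{R}}$ is $S^\nu(\mu|_{[x,\infty)})$. Put $c^{\mu,\nu}(x)=\sup_{k\in\mathbb{R}}\{C_{\mu|_{[x,\infty)}}(k)-C_\nu(k)\}$, $x_1=\inf\{x\in\mathbb{R}:c^{\mu,\nu}(x)=0\}$ (with $\inf\emptyset=r_\mu$) and $y_1=\ell_{S^\nu(\mu|_{[x_1,\infty)})}$. Then: (i) the set of martingale points of $\hat{\mathbb P}$, i.e. of those $x$ with $\mathbb{E}[Y|X=x]=x$, which is unique up to $\mu$-null sets, is $M=[x_1,r_\mu)\cap\mathbb{R}$; (ii) the second marginal of $\hat{\mathbb P}|_{M\times\mathbb{R}}$ is $\nu|_{[y_1,r_\nu)}$; (iii) on $(-\infty,x_1)\times\mathbb{R}$,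 $\hat{\mathbb P}$ coincides with the quantile coupling $\mu(dx)\,\delta_{F_\nu^{-1}(F_\mu(x))}(dy)$ of $\mu$ and $\nu$, where $F_\mu,F_\nu$ are the distribution functions and $F_\nu^{-1}(t)=\inf\{y:F_\nu(y)>t\}$. -/

import Mathlib

open MeasureTheory ProbabilityTheory

namespace SMOT

noncomputable section

/-- Left end point `ℓ_η = inf supp η` of the support of a measure on the line. -/
def leftEnd (η : Measure ℝ) : EReal := sInf ((↑) '' η.support)

/-- Right end point `r_η = sup supp η` of the support of a measure on the line. -/
def rightEnd (η : Measure ℝ) : EReal := sSup ((↑) '' η.support)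

/-- The half-open interval `[a, b)` of the real line, with extended real end points. -/
def realIco (a b : EReal) : Set ℝ := {x : ℝ | a ≤ (x : EReal) ∧ (x : EReal) < b}

/-- Convex-decreasing order of finite measures with finite first moments: `η(φ) ≤ χ(φ)` for every
convex non-increasing `φ : ℝ → ℝ`. Such a `φ` is bounded below by an affine function, so both
integrals have values in `(-∞, ∞]`; the inequality between them is spelled out as: if `χ(φ)` is
finite, then so is `η(φ)`, and `η(φ) ≤ χ(φ)`. Constant `φ` force equal total masses. -/
def ConvexDecLE (η χ : Measure ℝ) : Prop :=
  ∀ φ : ℝ → ℝ, ConvexOn ℝ Set.univ φ → Antitone φ → Integrable φ χ →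
    Integrable φ η ∧ ∫ x, φ x ∂η ≤ ∫ x, φ x ∂χ

/-- `θ` is the shadow of `η` in `ν`: the smallest element, with respect to the convex-decreasing
order, of `{θ : η ≤_cd θ, θ ≤ ν}`. -/
structure IsShadow (ν η θ : Measure ℝ) : Prop where
  convexDecLE : ConvexDecLE η θ
  le : θ ≤ ν
  least : ∀ θ' : Measure ℝ, ConvexDecLE η θ' → θ' ≤ ν → ConvexDecLE θ θ'

open Classical in
/-- The shadow measure `S^ν(η)` (zero if there is no shadow). -/
def shadow (ν η : Measure ℝ) : Measure ℝ :=
  if h : ∃ θ, IsShadow ν η θ then h.choose else 0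

/-- The conditional expectation `E^P[Y | X]` of the second coordinate given the first one. -/
def condMean (P : Measure (ℝ × ℝ)) : ℝ × ℝ → ℝ :=
  P[(Prod.snd : ℝ × ℝ → ℝ) | MeasurableSpace.comap (Prod.fst : ℝ × ℝ → ℝ) inferInstance]

/-- Supermartingale couplings of `μ` and `ν`. -/
structure IsSupermartingaleCoupling (μ ν : Measure ℝ) (P : Measure (ℝ × ℝ)) : Prop where
  fst_eq : P.fst = μ
  snd_eq : P.snd = ν
  condMean_le : ∀ᵐ p ∂P, condMean P p ≤ p.1

/-- The decreasing supermartingale coupling of `μ` and `ν`: the supermartingale coupling that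
transports `μ|_{[x, ∞)}` to its shadow in `ν`, for every real `x`. -/
structure IsDecreasingCoupling (μ ν : Measure ℝ) (P : Measure (ℝ × ℝ)) : Prop
    extends IsSupermartingaleCoupling μ ν P where
  isShadow : ∀ x : ℝ,
    IsShadow ν (μ.restrict (Set.Ici x)) (P.restrict (Prod.fst ⁻¹' Set.Ici x)).snd

/-- `M` is the set of martingale points of `P`, i.e. the set of all `x` with `E^P[Y | X = x] = x`
(determined up to null sets of the first marginal). -/
structure IsMartingalePointSet (P : Measure (ℝ × ℝ)) (M : Set ℝ) : Prop where
  measurableSet : MeasurableSet M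
  mem_iff : ∀ᵐ p ∂P, p.1 ∈ M ↔ condMean P p = p.1

/-- `C_η(k) = ∫ (x - k)⁺ η(dx)`. -/
def callFun (η : Measure ℝ) (k : ℝ) : ℝ := ∫ x, max (x - k) 0 ∂η

/-- `c^{μ,ν}(x) = sup_k {C_{μ|[x,∞)}(k) - C_ν(k)}`. -/
def gap (μ ν : Measure ℝ) (x : ℝ) : EReal :=
  ⨆ k : ℝ, ((callFun (μ.restrict (Set.Ici x)) k - callFun ν k : ℝ) : EReal)

open Classical in
/-- `x₁^{μ,ν} = inf {x ∈ ℝ : c^{μ,ν}(x) = 0}`, with `inf ∅ = r_μ`. -/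
def xOne (μ ν : Measure ℝ) : EReal :=
  if {x : ℝ | gap μ ν x = 0}.Nonempty then sInf ((↑) '' {x : ℝ | gap μ ν x = 0}) else rightEnd μ

/-- `y₁^{μ,ν}`, the left end point of the shadow of `μ|_{[x₁, ∞)}` in `ν`. -/
def yOne (μ ν : Measure ℝ) : EReal :=
  leftEnd (shadow ν (μ.restrict {x : ℝ | xOne μ ν ≤ (x : EReal)}))

/-- The right-continuous inverse `F_ν⁻¹(t) = inf {y : F_ν(y) > t}` of the distribution function. -/
def rightInvCdf (ν : Measure ℝ) (t : ℝ) : ℝ := sInf {y : ℝ | t < cdf ν y}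

/-- The quantile coupling `μ(dx) δ_{F_ν⁻¹(F_μ(x))}(dy)` (for `μ` without atoms). -/
def quantileCoupling (μ ν : Measure ℝ) : Measure (ℝ × ℝ) :=
  μ.map fun x => (x, rightInvCdf ν (cdf μ x))

/-- The Dispersion Assumption on `μ` and `ν`. -/
def Dispersion (μ ν : Measure ℝ) : Prop :=
  ∃ f g : ℝ → ℝ, Measurable f ∧ Measurable g ∧ (∀ x, 0 ≤ f x) ∧ (∀ x, 0 ≤ g x) ∧
    μ = volume.withDensity (fun x => ENNReal.ofReal (f x)) ∧
    ν = volume.withDensity (fun x => ENNReal.ofReal (g x)) ∧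
    (∀ x : ℝ, leftEnd μ < x → x < rightEnd μ → 0 < f x) ∧
    (∀ x : ℝ, leftEnd ν < x → x < rightEnd ν → 0 < g x) ∧
    leftEnd ν ≤ leftEnd μ ∧ leftEnd μ < rightEnd μ ∧ rightEnd μ ≤ rightEnd ν ∧
    ∃ m m' : ℝ, leftEnd μ < m ∧ m < m' ∧ m' < rightEnd μ ∧
      (∀ x : ℝ, m < x → x < m' → g x < f x) ∧
      (∀ x : ℝ, leftEnd ν < x → x < m → f x < g x) ∧
      (∀ x : ℝ, m' < x → x < rightEnd ν → f x < g x) ∧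
      f m = g m ∧ f m' = g m'

end

end SMOT

namespace SMOT

open Set Filter Topology

/-! ### Finite measures on the line -/

/-! Everything comes from identifying the shadow of `μ|[x, ∞)` with an upper tail `ν|[q, ∞)` of the
same mass when `x < x₁`. For such `x` some call is dearer on `μ|[x, ∞)` than on `ν`. The dispersion
assumption gives `f ≤ g` off `[m, m']` and `f ≥ g` on it, so a convex function minus its chord over
`[max x m, m']` has the same sign pattern as the difference of the tail densities
(`Crossing.chord_le`). Applied to the dear call, this shows that the `ν`-tail has the smaller mean;
applied to decreasing convex functions, it then gives `μ|[x, ∞) ≤_cd ν|[q, ∞)`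
(`Crossing.convexDecLE_tail`). An upper tail dominates no other measure below `ν`
(`eq_restrict_Ici_of_convexDecLE`), hence it is the shadow.

Consequently `X ≥ x` and `Y ≥ q` agree almost surely for each such `x`, that is, `F_ν(Y) = F_μ(X)`
on `X < x₁` (`Crossing.ae_cdf_eq`): this is the quantile coupling. There `F_μ < F_ν`, so `Y < X` and
no point is a martingale point.

At `x₁` all calls on `μ|[x₁, ∞)` are dominated, while the rank inequalities still send this mass
onto a tail of `ν`. The call struck at the left end of the tail shows that the mean does not drop
(`Crossing.exists_snd_eq_xOne`), and a supermartingale whose mean does not drop is a martingale. -/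

lemma measure_eq_of_le_of_univ_le {α : Type*} [MeasurableSpace α] {θ η : Measure α}
    [IsFiniteMeasure η] (h : θ ≤ η) (hm : η univ ≤ θ univ) : θ = η := by
  have : IsFiniteMeasure θ := ⟨(h univ).trans_lt (measure_lt_top η univ)⟩
  refine Measure.ext fun s hs => le_antisymm (h s) ?_
  have h1 : η s + η sᶜ ≤ θ s + η sᶜ := by
    calc η s + η sᶜ = η univ := measure_add_measure_compl hs
      _ ≤ θ univ := hm
      _ = θ s + θ sᶜ := (measure_add_measure_compl hs).symm
      _ ≤ θ s + η sᶜ := by gcongr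
  exact (ENNReal.add_le_add_iff_right (measure_ne_top η _)).1 h1

lemma ConvexDecLE.isFiniteMeasure {η χ : Measure ℝ} [IsFiniteMeasure χ] (h : ConvexDecLE η χ) :
    IsFiniteMeasure η := by
  have h1 := (h (fun _ => 1) (convexOn_const 1 convex_univ) antitone_const
    (integrable_const 1)).1
  simpa [integrable_const_iff] using h1

lemma ConvexDecLE.univ_eq {η χ : Measure ℝ} [IsFiniteMeasure χ] (h : ConvexDecLE η χ) :
    η univ = χ univ := by
  have := h.isFiniteMeasure
  have h1 := (h (fun _ => 1) (convexOn_const 1 convex_univ) antitone_const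
    (integrable_const 1)).2
  have h2 := (h (fun _ => -1) (convexOn_const _ convex_univ) antitone_const
    (integrable_const _)).2
  simp only [integral_const, smul_eq_mul] at h1 h2
  have h3 : η.real univ = χ.real univ := by linarith
  exact (measureReal_eq_measureReal_iff).1 h3

lemma ConvexDecLE.refl (η : Measure ℝ) : ConvexDecLE η η := fun _ _ _ hi => ⟨hi, le_rfl⟩

lemma convexOn_call (k : ℝ) : ConvexOn ℝ univ (fun y : ℝ => max (y - k) 0) :=
  ((((convexOn_id convex_univ).add_const (-k)).congr fun y _ => by simp; ring).sup
    (convexOn_const 0 convex_univ))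

lemma convexOn_put (k : ℝ) : ConvexOn ℝ univ (fun y : ℝ => max (k - y) 0) :=
  ((concaveOn_id convex_univ).neg.add_const k |>.congr (fun y _ => by simp; ring)).sup
    (convexOn_const 0 convex_univ)

/-- A measure below `ν` which is dominated in convex-decreasing order by an upper tail of `ν`
is that tail. -/
lemma eq_restrict_Ici_of_convexDecLE {ν θ : Measure ℝ} [IsFiniteMeasure ν] {q : ℝ}
    (hle : θ ≤ ν) (h : ConvexDecLE θ (ν.restrict (Ici q))) : θ = ν.restrict (Ici q) := by
  -- The put struck at `q` is worthless on the tail, hence on `θ`, which confines `θ` to `[q, ∞)`.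
  have hz : (fun y : ℝ => max (q - y) 0) =ᵐ[ν.restrict (Ici q)] 0 := by
    filter_upwards [ae_restrict_mem measurableSet_Ici] with y hy
    simpa using hy
  obtain ⟨hi, hint⟩ := h (fun y => max (q - y) 0) (convexOn_put q)
    (fun a b hab => by dsimp only; gcongr) ((integrable_zero ℝ ℝ _).congr hz.symm)
  rw [integral_congr_ae hz] at hint
  simp only [Pi.zero_apply, integral_zero] at hint
  have h0 : ∫ y, max (q - y) 0 ∂θ = 0 :=
    le_antisymm hint (integral_nonneg fun y => le_max_right _ _)
  have h1 := (integral_eq_zero_iff_of_nonneg (fun y => le_max_right _ _) hi).1 h0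
  have h2 : ∀ᵐ y ∂θ, y ∈ Ici q := by
    filter_upwards [h1] with y hy
    simpa using hy
  refine measure_eq_of_le_of_univ_le ?_ h.univ_eq.ge
  rw [← Measure.restrict_eq_self_of_ae_mem h2]
  exact Measure.restrict_mono le_rfl hle

/-- Once the tail is a competitor, leastness puts the shadow below it, and nothing else under `ν`
lies there. -/
lemma IsShadow.eq_restrict_Ici {ν η θ : Measure ℝ} [IsFiniteMeasure ν] {q : ℝ}
    (hθ : IsShadow ν η θ) (h : ConvexDecLE η (ν.restrict (Ici q))) : θ = ν.restrict (Ici q) :=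
  eq_restrict_Ici_of_convexDecLE hθ.le (hθ.least _ h Measure.restrict_le_self)

lemma isShadow_shadow {ν η θ : Measure ℝ} (h : IsShadow ν η θ) : IsShadow ν η (shadow ν η) := by
  have h' : ∃ θ, IsShadow ν η θ := ⟨θ, h⟩
  rw [shadow, dif_pos h']
  exact h'.choose_spec

/-! ### Distribution functions -/

section Cdf

variable (μ : Measure ℝ) [IsProbabilityMeasure μ] [NullSingletonClass μ]

lemma measureReal_Ici (x : ℝ) : μ.real (Ici x) = 1 - cdf μ x := by
  rw [cdf_eq_real, ← probReal_compl_eq_one_sub measurableSet_Iic, compl_Iic]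
  exact measureReal_congr Ioi_ae_eq_Ici.symm

lemma continuous_cdf : Continuous (cdf μ) := by
  refine continuous_iff_continuousAt.2 fun x => ?_
  rw [(cdf μ).mono.continuousAt_iff_leftLim_eq_rightLim, (cdf μ).rightLim_eq]
  have h : (cdf μ).measure {x} = 0 := by rw [measure_cdf]; exact measure_singleton x
  rw [StieltjesFunction.measure_singleton, ENNReal.ofReal_eq_zero] at h
  exact le_antisymm ((cdf μ).mono.leftLim_le le_rfl) (by linarith)

/-- The smallest quantile of level `c` of an atomless law. -/
lemma exists_quantile {c : ℝ} (h0 : 0 < c) (h1 : c < 1) :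
    ∃ q, cdf μ q = c ∧ ∀ y, c ≤ cdf μ y ↔ q ≤ y := by
  have hcl : IsClosed {y | c ≤ cdf μ y} := isClosed_le continuous_const (continuous_cdf μ)
  have hne : {y | c ≤ cdf μ y}.Nonempty :=
    ((tendsto_cdf_atTop μ).eventually_const_le h1).exists
  obtain ⟨b, hb⟩ := ((tendsto_cdf_atBot μ).eventually_lt_const h0).exists
  have hbd : BddBelow {y | c ≤ cdf μ y} :=
    ⟨b, fun y hy => le_of_not_gt fun hyb => (hb.trans_le hy).not_ge (monotone_cdf μ hyb.le)⟩
  have hmem := hcl.csInf_mem hne hbd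
  have hiff : ∀ y, c ≤ cdf μ y ↔ sInf {y | c ≤ cdf μ y} ≤ y :=
    fun y => ⟨fun hy => csInf_le hbd hy, fun hy => hmem.trans (monotone_cdf μ hy)⟩
  refine ⟨_, le_antisymm ?_ hmem, hiff⟩
  refine le_of_tendsto ((continuous_cdf μ).continuousAt.mono_left
    (nhdsWithin_le_nhds (s := Iio (sInf {y | c ≤ cdf μ y})))) ?_
  filter_upwards [self_mem_nhdsWithin] with y hy
  exact (not_le.1 fun h => (not_le.2 hy) ((hiff y).1 h)).le

end Cdf

/-! ### End points of the support -/

lemma ae_leftEnd_le (μ : Measure ℝ) : ∀ᵐ x : ℝ ∂μ, leftEnd μ ≤ x := by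
  filter_upwards [μ.support_mem_ae] with x hx
  exact sInf_le ⟨x, hx, rfl⟩

lemma ae_le_rightEnd (μ : Measure ℝ) : ∀ᵐ x : ℝ ∂μ, (x : EReal) ≤ rightEnd μ := by
  filter_upwards [μ.support_mem_ae] with x hx
  exact le_sSup ⟨x, hx, rfl⟩

lemma ae_coe_ne (μ : Measure ℝ) [NullSingletonClass μ] (a : EReal) :
    ∀ᵐ x : ℝ ∂μ, (x : EReal) ≠ a := by
  induction a with
  | bot => exact ae_of_all _ fun x => EReal.coe_ne_bot x
  | top => exact ae_of_all _ fun x => EReal.coe_ne_top x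
  | coe a =>
    have : ∀ᵐ x : ℝ ∂μ, x ≠ a := by simp [ae_iff]
    filter_upwards [this] with x hx
    exact_mod_cast hx

lemma ae_leftEnd_lt (μ : Measure ℝ) [NullSingletonClass μ] : ∀ᵐ x : ℝ ∂μ, leftEnd μ < x := by
  filter_upwards [ae_leftEnd_le μ, ae_coe_ne μ (leftEnd μ)] with x h1 h2
  exact lt_of_le_of_ne h1 h2.symm

lemma ae_lt_rightEnd (μ : Measure ℝ) [NullSingletonClass μ] :
    ∀ᵐ x : ℝ ∂μ, (x : EReal) < rightEnd μ := by
  filter_upwards [ae_le_rightEnd μ, ae_coe_ne μ (rightEnd μ)] with x h1 h2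
  exact lt_of_le_of_ne h1 h2

lemma cdf_pos_of_leftEnd_lt {μ : Measure ℝ} [IsProbabilityMeasure μ] {x : ℝ}
    (h : leftEnd μ < x) : 0 < cdf μ x := by
  obtain ⟨_, ⟨y, hy, rfl⟩, hyx⟩ := sInf_lt_iff.1 h
  have hpos := (Measure.mem_support_iff_forall y).1 hy (Iic x) (Iic_mem_nhds (by exact_mod_cast hyx))
  rw [cdf_eq_real]
  exact ENNReal.toReal_pos hpos.ne' (measure_ne_top _ _)

lemma cdf_lt_one_of_lt_rightEnd {μ : Measure ℝ} [IsProbabilityMeasure μ] {x : ℝ}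
    (h : x < rightEnd μ) : cdf μ x < 1 := by
  obtain ⟨_, ⟨y, hy, rfl⟩, hyx⟩ := lt_sSup_iff.1 h
  have hpos := (Measure.mem_support_iff_forall y).1 hy (Ioi x) (Ioi_mem_nhds (by exact_mod_cast hyx))
  have h1 : 0 < μ.real (Ioi x) := ENNReal.toReal_pos hpos.ne' (measure_ne_top _ _)
  rw [← compl_Iic, probReal_compl_eq_one_sub measurableSet_Iic, ← cdf_eq_real] at h1
  linarith

lemma leftEnd_lt_of_cdf_pos {μ : Measure ℝ} [IsProbabilityMeasure μ] [NullSingletonClass μ] {x : ℝ}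
    (h : 0 < cdf μ x) : leftEnd μ < x := by
  by_contra hx
  have h0 : μ (Iic x) = 0 := by
    rw [measure_eq_zero_iff_ae_notMem]
    filter_upwards [ae_leftEnd_lt μ] with y hy hyx
    exact hx (hy.trans_le (by exact_mod_cast hyx))
  rw [cdf_eq_real, measureReal_def, h0] at h
  simp at h

lemma measurableSet_realIco (a b : EReal) : MeasurableSet (realIco a b) :=
  (measurableSet_le measurable_const measurable_coe_real_ereal).inter
    (measurableSet_lt measurable_coe_real_ereal measurable_const)

/-- The left end of `ν|s` may lie to the right of `inf s`, but the part of `s` in between is null. A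
general closed up-set covers both a ray and the whole line. -/
lemma restrict_realIco_leftEnd (ν : Measure ℝ) [NullSingletonClass ν] {s : Set ℝ} (hs : IsClosed s)
    (hup : IsUpperSet s) :
    ν.restrict (realIco (leftEnd (ν.restrict s)) (rightEnd ν)) = ν.restrict s := by
  refine Measure.restrict_congr_set ?_
  filter_upwards [(ae_restrict_iff' hs.measurableSet).1 (ae_leftEnd_le (ν.restrict s)),
    ae_lt_rightEnd ν] with y h1 h2
  refine propext ⟨fun hy => ?_, fun hy => ⟨h1 hy, h2⟩⟩
  by_contra hys
  obtain ⟨z, hyz, hz⟩ : ∃ z, y < z ∧ z ∉ s :=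
    ((eventually_mem_nhdsWithin (a := y) (s := Ioi y)).and
      (mem_nhdsWithin_of_mem_nhds (hs.isOpen_compl.mem_nhds hys))).exists
  have hle : (z : EReal) ≤ leftEnd (ν.restrict s) := by
    refine le_sInf ?_
    rintro _ ⟨t, ht, rfl⟩
    have hts : t ∈ s :=
      Measure.support_subset_of_isClosed hs (ae_restrict_mem hs.measurableSet) ht
    exact_mod_cast le_of_not_ge fun h => hz (hup h hts)
  exact (hle.trans hy.1).not_gt (by exact_mod_cast hyz)

/-! ### Call functions -/

lemma integrable_call {η : Measure ℝ} [IsFiniteMeasure η] (hη : Integrable (fun x : ℝ => x) η)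
    (k : ℝ) : Integrable (fun x : ℝ => max (x - k) 0) η :=
  (hη.sub (integrable_const k)).pos_part

lemma tendsto_callFun_atTop {η : Measure ℝ} [IsFiniteMeasure η]
    (hη : Integrable (fun x : ℝ => x) η) : Tendsto (callFun η) atTop (𝓝 0) := by
  have h : Tendsto (fun k : ℝ => ∫ x, max (x - k) 0 ∂η) atTop (𝓝 (∫ _, (0 : ℝ) ∂η)) := by
    refine tendsto_integral_filter_of_dominated_convergence (fun x => |x|)
      (Eventually.of_forall fun k => (integrable_call hη k).1) ?_ hη.abs ?_
    · filter_upwards [eventually_ge_atTop 0] with k hk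
      refine ae_of_all _ fun x => ?_
      rw [Real.norm_of_nonneg (le_max_right _ _)]
      exact max_le (by linarith [le_abs_self x]) (abs_nonneg x)
    · refine ae_of_all _ fun x => tendsto_const_nhds.congr' ?_
      filter_upwards [eventually_ge_atTop x] with k hk
      rw [max_eq_right (by linarith)]
  rw [integral_zero] at h
  exact h

/-- Both call functions tend to zero at large strikes, so the supremum is never negative. -/
lemma gap_eq_zero_iff {μ ν : Measure ℝ} [IsFiniteMeasure μ] [IsFiniteMeasure ν]
    (hμ : Integrable (fun x : ℝ => x) μ) (hν : Integrable (fun x : ℝ => x) ν) (x : ℝ) :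
    gap μ ν x = 0 ↔ ∀ k, callFun (μ.restrict (Ici x)) k ≤ callFun ν k := by
  constructor
  · intro h k
    have h1 : ((callFun (μ.restrict (Ici x)) k - callFun ν k : ℝ) : EReal) ≤ 0 :=
      h ▸ le_iSup (fun k : ℝ => ((callFun (μ.restrict (Ici x)) k - callFun ν k : ℝ) : EReal)) k
    have h2 : callFun (μ.restrict (Ici x)) k - callFun ν k ≤ 0 := by exact_mod_cast h1
    linarith
  · intro h
    refine le_antisymm (iSup_le fun k => ?_) ?_
    · have := h k
      exact_mod_cast sub_nonpos.2 this
    · have ht : Tendsto (fun k => callFun (μ.restrict (Ici x)) k - callFun ν k) atTop (𝓝 0) := by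
        simpa using (tendsto_callFun_atTop hμ.integrableOn).sub (tendsto_callFun_atTop hν)
      have ht' : Tendsto (fun k => ((callFun (μ.restrict (Ici x)) k - callFun ν k : ℝ) : EReal))
          atTop (𝓝 ((0 : ℝ) : EReal)) := (continuous_coe_real_ereal.tendsto 0).comp ht
      exact le_of_tendsto' ht' fun k =>
        le_iSup (fun k : ℝ => ((callFun (μ.restrict (Ici x)) k - callFun ν k : ℝ) : EReal)) k

/-! ### Measures with densities -/

section Density

variable {f : ℝ → ℝ} {s : Set ℝ} {φ : ℝ → ℝ}

lemma integrableOn_withDensity_iff (hf : Measurable f) (hf0 : ∀ x, 0 ≤ f x)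
    (hs : MeasurableSet s) :
    IntegrableOn φ s (volume.withDensity fun x => ENNReal.ofReal (f x)) ↔
      Integrable fun y => s.indicator f y * φ y := by
  rw [IntegrableOn, restrict_withDensity hs, integrable_withDensity_iff_integrable_smul'
    hf.ennreal_ofReal (ae_of_all _ fun _ => ENNReal.ofReal_lt_top), ← IntegrableOn,
    ← integrable_indicator_iff hs]
  refine iff_of_eq (congrArg (fun h => Integrable h volume) (funext fun y => ?_))
  by_cases hy : y ∈ s <;> simp [hy, hf0 y]

lemma setIntegral_withDensity (hf : Measurable f) (hf0 : ∀ x, 0 ≤ f x) (hs : MeasurableSet s) :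
    ∫ y in s, φ y ∂(volume.withDensity fun x => ENNReal.ofReal (f x)) =
      ∫ y, s.indicator f y * φ y := by
  rw [restrict_withDensity hs, integral_withDensity_eq_integral_toReal_smul
    hf.ennreal_ofReal (ae_of_all _ fun _ => ENNReal.ofReal_lt_top), ← integral_indicator hs]
  refine integral_congr_ae (ae_of_all _ fun y => ?_)
  by_cases hy : y ∈ s <;> simp [hy, hf0 y]

end Density

/-- `μ` and `ν` have densities `f` and `g` with `f ≤ g` off `[m, m']` and `g ≤ f` on `[m, m']`. -/
structure Crossing (μ ν : Measure ℝ) (f g : ℝ → ℝ) (m m' : ℝ) : Prop where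
  measurable_f : Measurable f
  measurable_g : Measurable g
  f_nonneg : ∀ x, 0 ≤ f x
  g_nonneg : ∀ x, 0 ≤ g x
  left_eq : μ = volume.withDensity fun x => ENNReal.ofReal (f x)
  right_eq : ν = volume.withDensity fun x => ENNReal.ofReal (g x)
  lt : m < m'
  mid : ∀ y ∈ Icc m m', g y ≤ f y
  left : ∀ᵐ y : ℝ, y < m → f y ≤ g y
  right : ∀ᵐ y : ℝ, m' < y → f y ≤ g y

/-! ### Tail comparisons for densities that cross twice -/

namespace Crossing

variable {μ ν : Measure ℝ} {f g : ℝ → ℝ} {m m' : ℝ}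

lemma nullSingletonClass_left (h : Crossing μ ν f g m m') : NullSingletonClass μ :=
  ⟨fun x => by
    rw [h.left_eq]; exact withDensity_absolutelyContinuous _ _ (measure_singleton x)⟩

lemma nullSingletonClass_right (h : Crossing μ ν f g m m') : NullSingletonClass ν :=
  ⟨fun x => by
    rw [h.right_eq]; exact withDensity_absolutelyContinuous _ _ (measure_singleton x)⟩

/-- Indicators move into the densities, so that tails of `μ` and `ν` over different sets are
compared pointwise under Lebesgue measure. -/
lemma setIntegral_le (h : Crossing μ ν f g m m') {s t : Set ℝ} {ψ : ℝ → ℝ}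
    (hs : MeasurableSet s) (ht : MeasurableSet t) (hi : IntegrableOn ψ s μ)
    (hj : IntegrableOn ψ t ν)
    (hle : ∀ᵐ y : ℝ, s.indicator f y * ψ y ≤ t.indicator g y * ψ y) :
    ∫ y in s, ψ y ∂μ ≤ ∫ y in t, ψ y ∂ν := by
  have hi' := hi
  have hj' := hj
  rw [h.left_eq, integrableOn_withDensity_iff h.measurable_f h.f_nonneg hs] at hi'
  rw [h.right_eq, integrableOn_withDensity_iff h.measurable_g h.g_nonneg ht] at hj'
  rw [h.left_eq, h.right_eq, setIntegral_withDensity h.measurable_f h.f_nonneg hs,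
    setIntegral_withDensity h.measurable_g h.g_nonneg ht]
  exact integral_mono_ae hi' hj' hle

lemma integrableOn_Ici (h : Crossing μ ν f g m m') [IsFiniteMeasure μ] {x q : ℝ} (hq : q ≤ m')
    {φ : ℝ → ℝ} (hφ : Continuous φ) (hi : IntegrableOn φ (Ici q) ν) :
    IntegrableOn φ (Ici x) μ := by
  have h1 : IntegrableOn φ (Ioi m') μ := by
    have hi' : IntegrableOn φ (Ioi m') ν := hi.mono_set fun y hy => hq.trans (le_of_lt hy)
    rw [h.right_eq, integrableOn_withDensity_iff h.measurable_g h.g_nonneg measurableSet_Ioi] at hi'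
    rw [h.left_eq, integrableOn_withDensity_iff h.measurable_f h.f_nonneg measurableSet_Ioi]
    refine hi'.mono ((h.measurable_f.indicator measurableSet_Ioi).mul
      hφ.measurable).aestronglyMeasurable ?_
    filter_upwards [h.right] with y hy
    by_cases hym : y ∈ Ioi m'
    · simp only [hym, indicator_of_mem, norm_mul, Real.norm_eq_abs, abs_of_nonneg (h.f_nonneg y),
        abs_of_nonneg (h.g_nonneg y)]
      gcongr
      exact hy hym
    · simp [hym]
  have h2 : IntegrableOn φ (Icc x m') μ := hφ.integrableOn_Icc
  refine (h2.union h1).mono_set fun y hy => ?_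
  rcases le_or_gt y m' with hym | hym
  · exact Or.inl ⟨hy, hym⟩
  · exact Or.inr hym

/-- Comparison of a convex function with its chord over the interval where `f` dominates `g`. -/
lemma chord_le (h : Crossing μ ν f g m m') [IsFiniteMeasure μ] [IsFiniteMeasure ν]
    (hμ : Integrable (fun x : ℝ => x) μ) (hν : Integrable (fun x : ℝ => x) ν) {x q : ℝ}
    (hqx : q ≤ x) (hx : x < m') (hmass : ν.real (Ici q) = μ.real (Ici x))
    {φ : ℝ → ℝ} (hφ : ConvexOn ℝ univ φ) (hi : IntegrableOn φ (Ici q) ν) :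
    (φ m' - φ (max x m)) / (m' - max x m) *
        (∫ y in Ici q, y ∂ν - ∫ y in Ici x, y ∂μ) ≤
      ∫ y in Ici q, φ y ∂ν - ∫ y in Ici x, φ y ∂μ := by
  have hcont : Continuous φ := continuousOn_univ.1 (hφ.continuousOn isOpen_univ)
  have hj : IntegrableOn φ (Ici x) μ := h.integrableOn_Ici (hqx.trans hx.le) hcont hi
  -- To the left of `a` either `μ|[x, ∞)` has no mass or `f ≤ g`; on `[a, m']` both tails are
  -- present and `f ≥ g`.
  set a := max x m with ha
  have hab : 0 < m' - a := sub_pos.2 (max_lt hx h.lt)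
  set s := (φ m' - φ a) / (m' - a) with hs
  have hsab : s * (m' - a) = φ m' - φ a := div_mul_cancel₀ _ hab.ne'
  have hin : ∀ y, a ≤ y → y ≤ m' → φ y - (φ a + s * (y - a)) ≤ 0 := by
    intro y h1 h2
    rcases h1.eq_or_lt with rfl | h1
    · simp
    rcases h2.eq_or_lt with rfl | h2
    · linarith
    have := hφ.secant_mono_aux1 (mem_univ a) (mem_univ m') h1 h2
    refine nonpos_of_mul_nonpos_right (a := m' - a) ?_ hab
    nlinarith
  have hleft : ∀ y, y < a → 0 ≤ φ y - (φ a + s * (y - a)) := by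
    intro y h1
    have := hφ.secant_mono_aux1 (mem_univ y) (mem_univ m') h1 (sub_pos.1 hab)
    refine nonneg_of_mul_nonneg_right (a := m' - a) ?_ hab
    nlinarith
  have hright : ∀ y, m' < y → 0 ≤ φ y - (φ a + s * (y - a)) := by
    intro y h1
    have := hφ.secant_mono_aux1 (mem_univ a) (mem_univ y) (sub_pos.1 hab) h1
    refine nonneg_of_mul_nonneg_right (a := m' - a) ?_ hab
    nlinarith
  have hLμ : IntegrableOn (fun y => φ a + s * (y - a)) (Ici x) μ :=
    (integrable_const _).add ((hμ.integrableOn.sub (integrable_const _)).const_mul _)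
  have hLν : IntegrableOn (fun y => φ a + s * (y - a)) (Ici q) ν :=
    (integrable_const _).add ((hν.integrableOn.sub (integrable_const _)).const_mul _)
  have key := h.setIntegral_le (ψ := fun y => φ y - (φ a + s * (y - a)))
    measurableSet_Ici measurableSet_Ici (hj.sub hLμ) (hi.sub hLν) (by
      filter_upwards [h.left, h.right] with y hl hr
      rcases lt_or_ge y a with hya | hya
      · refine mul_le_mul_of_nonneg_right ?_ (hleft y hya)
        by_cases hyx : x ≤ y
        · have hym : y < m := by
            rcases lt_max_iff.1 hya with h1 | h1
            · exact absurd hyx h1.not_ge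
            · exact h1
          simpa [hyx, hqx.trans hyx] using hl hym
        · rw [indicator_of_notMem (by simpa using hyx)]
          exact indicator_nonneg (fun _ _ => h.g_nonneg _) _
      have hxy : x ≤ y := (le_max_left _ _).trans hya
      have hmy : m ≤ y := (le_max_right _ _).trans hya
      simp only [mem_Ici, hxy, hqx.trans hxy, indicator_of_mem]
      rcases lt_or_ge m' y with hy | hy
      · exact mul_le_mul_of_nonneg_right (hr hy) (hright y hy)
      · exact mul_le_mul_of_nonpos_right (h.mid y ⟨hmy, hy⟩) (hin y hya hy))
  have hLμ' : ∫ y in Ici x, (φ a + s * (y - a)) ∂μ =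
      μ.real (Ici x) * (φ a - s * a) + s * ∫ y in Ici x, y ∂μ := by
    have : (fun y => φ a + s * (y - a)) = fun y => (φ a - s * a) + s * y := by ext; ring
    rw [this, integral_add (integrable_const _) (hμ.integrableOn.const_mul _),
      integral_const_mul]
    simp
  have hLν' : ∫ y in Ici q, (φ a + s * (y - a)) ∂ν =
      ν.real (Ici q) * (φ a - s * a) + s * ∫ y in Ici q, y ∂ν := by
    have : (fun y => φ a + s * (y - a)) = fun y => (φ a - s * a) + s * y := by ext; ring
    rw [this, integral_add (integrable_const _) (hν.integrableOn.const_mul _),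
      integral_const_mul]
    simp
  -- Equal masses cancel the constant part of the chord; only its slope times the difference of
  -- means remains.
  rw [integral_sub hj hLμ, integral_sub hi hLν, hLμ', hLν', hmass] at key
  linarith

/-- If some call on `μ|[x, ∞)` is worth more than the same call on `ν`, then `μ|[x, ∞)` is
dominated in convex-decreasing order by the upper tail of `ν` of the same mass. -/
lemma convexDecLE_tail (h : Crossing μ ν f g m m') [IsFiniteMeasure μ] [IsFiniteMeasure ν]
    (hμ : Integrable (fun x : ℝ => x) μ) (hν : Integrable (fun x : ℝ => x) ν) {x q k : ℝ}
    (hqx : q ≤ x) (hx : x < m') (hmass : ν.real (Ici q) = μ.real (Ici x))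
    (hk : callFun ν k < callFun (μ.restrict (Ici x)) k) :
    ConvexDecLE (μ.restrict (Ici x)) (ν.restrict (Ici q)) := by
  have hlt : max x m < m' := max_lt hx h.lt
  -- Otherwise the nonnegative chord slope of the call would make it at least as dear on `ν`.
  have hmean : ∫ y in Ici q, y ∂ν ≤ ∫ y in Ici x, y ∂μ := by
    by_contra! hcon
    have h1 := h.chord_le hμ hν hqx hx hmass (convexOn_call k) (integrable_call hν k).integrableOn
    have h2 : 0 ≤ (max (m' - k) 0 - max (max x m - k) 0) / (m' - max x m) :=
      div_nonneg (sub_nonneg.2 (by gcongr)) (sub_nonneg.2 hlt.le)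
    have h3 : ∫ y in Ici q, max (y - k) 0 ∂ν ≤ callFun ν k :=
      setIntegral_le_integral (integrable_call hν k) (ae_of_all _ fun _ => le_max_right _ _)
    have h4 := mul_nonneg h2 (sub_nonneg.2 hcon.le)
    have h5 : callFun (μ.restrict (Ici x)) k = ∫ y in Ici x, max (y - k) 0 ∂μ := rfl
    linarith
  intro φ hφ hanti hi
  refine ⟨h.integrableOn_Ici (hqx.trans hx.le)
    (continuousOn_univ.1 (hφ.continuousOn isOpen_univ)) hi, ?_⟩
  have h1 := h.chord_le hμ hν hqx hx hmass hφ hi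
  have h2 : (φ m' - φ (max x m)) / (m' - max x m) ≤ 0 :=
    div_nonpos_of_nonpos_of_nonneg (sub_nonpos.2 (hanti hlt.le)) (sub_nonneg.2 hlt.le)
  have h3 := mul_nonneg_of_nonpos_of_nonpos h2 (sub_nonpos.2 hmean)
  linarith

/-- On `[x, ∞)` the densities cross only at `m'`, and the call minus its value at `m'` changes sign
there too. The subtracted constant helps, since the tail of `ν` is at least as heavy. -/
lemma call_le_of_cdf_le (h : Crossing μ ν f g m m') [IsProbabilityMeasure μ]
    [IsProbabilityMeasure ν] (hμ : Integrable (fun x : ℝ => x) μ)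
    (hν : Integrable (fun x : ℝ => x) ν) {x : ℝ} (hx : m ≤ x) (hcdf : cdf ν x ≤ cdf μ x) (k : ℝ) :
    callFun (μ.restrict (Ici x)) k ≤ callFun ν k := by
  have := h.nullSingletonClass_left
  have := h.nullSingletonClass_right
  have hμk := (integrable_call hμ k).integrableOn (s := Ici x)
  have hνk := (integrable_call hν k).integrableOn (s := Ici x)
  have key := h.setIntegral_le (ψ := fun y => max (y - k) 0 - max (m' - k) 0)
    measurableSet_Ici measurableSet_Ici (hμk.sub (integrable_const _))
    (hνk.sub (integrable_const _)) (by
      filter_upwards [h.right] with y hr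
      by_cases hy : x ≤ y
      · simp only [mem_Ici, hy, indicator_of_mem]
        rcases lt_or_ge m' y with hym | hym
        · exact mul_le_mul_of_nonneg_right (hr hym) (sub_nonneg.2 (by gcongr))
        · exact mul_le_mul_of_nonpos_right (h.mid y ⟨hx.trans hy, hym⟩)
            (sub_nonpos.2 (by gcongr))
      · simp [hy])
  rw [integral_sub hμk (integrable_const _), integral_sub hνk (integrable_const _)] at key
  simp only [integral_const, MeasurableSet.univ, measureReal_restrict_apply, univ_inter,
    measureReal_Ici, smul_eq_mul] at key
  have h1 : callFun (μ.restrict (Ici x)) k = ∫ y in Ici x, max (y - k) 0 ∂μ := rfl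
  have h2 : ∫ y in Ici x, max (y - k) 0 ∂ν ≤ callFun ν k :=
    setIntegral_le_integral (integrable_call hν k) (ae_of_all _ fun _ => le_max_right _ _)
  have h3 : 0 ≤ (cdf μ x - cdf ν x) * max (m' - k) 0 :=
    mul_nonneg (sub_nonneg.2 hcdf) (le_max_right _ _)
  linarith

lemma cdf_right_le (h : Crossing μ ν f g m m') [IsProbabilityMeasure μ]
    [IsProbabilityMeasure ν] {x : ℝ} (hx : m' ≤ x) : cdf ν x ≤ cdf μ x := by
  have := h.nullSingletonClass_left
  have := h.nullSingletonClass_right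
  have key := h.setIntegral_le (s := Ioi x) (t := Ioi x) (ψ := fun _ => 1)
    measurableSet_Ioi measurableSet_Ioi (integrable_const _) (integrable_const _) (by
      filter_upwards [h.right] with y hr
      by_cases hy : x < y
      · simpa [hy] using hr (hx.trans_lt hy)
      · simp [hy])
  rw [← integral_Ici_eq_integral_Ioi, ← integral_Ici_eq_integral_Ioi] at key
  simp only [integral_const, MeasurableSet.univ, measureReal_restrict_apply, univ_inter,
    measureReal_Ici, smul_eq_mul] at key
  linarith

lemma cdf_lt_of_lt (h : Crossing μ ν f g m m') [IsProbabilityMeasure μ]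
    [IsProbabilityMeasure ν] (hlt : ∀ y : ℝ, leftEnd ν < y → y < m → f y < g y) {x : ℝ}
    (hx : x ≤ m) (hpos : 0 < cdf μ x) : cdf μ x < cdf ν x := by
  have := h.nullSingletonClass_left
  have := h.nullSingletonClass_right
  have hi : IntegrableOn (fun _ => (1 : ℝ)) (Iio x) μ := integrable_const _
  have hj : IntegrableOn (fun _ => (1 : ℝ)) (Iio x) ν := integrable_const _
  have hind : ∀ᵐ y : ℝ, (Iio x).indicator f y * 1 ≤ (Iio x).indicator g y * 1 := by
    filter_upwards [h.left] with y hl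
    by_cases hy : y < x
    · simpa [hy] using hl (hy.trans_le hx)
    · simp [hy]
  have hμx : cdf μ x = ∫ _ in Iio x, (1 : ℝ) ∂μ := by
    rw [← integral_Iic_eq_integral_Iio]; simp [cdf_eq_real]
  have hνx : cdf ν x = ∫ _ in Iio x, (1 : ℝ) ∂ν := by
    rw [← integral_Iic_eq_integral_Iio]; simp [cdf_eq_real]
  have hle : cdf μ x ≤ cdf ν x := by
    rw [hμx, hνx]; exact h.setIntegral_le measurableSet_Iio measurableSet_Iio hi hj hind
  refine lt_of_le_of_ne hle fun heq => ?_
  have hl : leftEnd ν < x := leftEnd_lt_of_cdf_pos (hpos.trans_le hle)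
  -- Equality would force `f = g` almost everywhere on the nondegenerate interval `(z, x)`, where `f
  -- < g`.
  obtain ⟨z, hz1, hz2⟩ := EReal.lt_iff_exists_real_btwn.1 hl
  have hzx : z < x := by exact_mod_cast hz2
  rw [hμx, hνx] at heq
  rw [h.left_eq, integrableOn_withDensity_iff h.measurable_f h.f_nonneg measurableSet_Iio] at hi
  rw [h.right_eq, integrableOn_withDensity_iff h.measurable_g h.g_nonneg measurableSet_Iio] at hj
  rw [h.left_eq, h.right_eq, setIntegral_withDensity h.measurable_f h.f_nonneg measurableSet_Iio,
    setIntegral_withDensity h.measurable_g h.g_nonneg measurableSet_Iio] at heq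
  have hae := (integral_eq_iff_of_ae_le hi hj hind).1 heq
  have hzero : volume (Ioo z x) = 0 := by
    rw [measure_eq_zero_iff_ae_notMem]
    filter_upwards [hae] with y hy hyz
    have h1 := hlt y (hz1.trans (by exact_mod_cast hyz.1)) (hyz.2.trans_le hx)
    simp only [mem_Iio, hyz.2, indicator_of_mem, mul_one] at hy
    exact h1.ne hy
  rw [Real.volume_Ioo, ENNReal.ofReal_eq_zero] at hzero
  linarith

lemma cdf_strict (h : Crossing μ ν f g m m') [IsProbabilityMeasure ν]
    (hgpos : ∀ y : ℝ, leftEnd ν < y → y < rightEnd ν → 0 < g y) (a b : ℝ)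
    (hla : leftEnd ν < a) (har : a < rightEnd ν) (hab : a < b) : cdf ν a < cdf ν b := by
  refine lt_of_le_of_ne (monotone_cdf ν hab.le) fun heq => ?_
  -- Since `b` may exceed `r_ν`, positivity of `g` is used only up to some `c` below both.
  obtain ⟨c, hac, hc⟩ := EReal.lt_iff_exists_real_btwn.1
    (lt_min (show (a : EReal) < b by exact_mod_cast hab) har)
  have hcb : c < b := by exact_mod_cast hc.trans_le (min_le_left _ _)
  have h0 : ν (Ioc a b) = 0 := by
    conv_lhs => rw [← measure_cdf (μ := ν)]
    rw [StieltjesFunction.measure_Ioc, heq, sub_self, ENNReal.ofReal_zero]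
  have h1 : ν (Ioo a c) = 0 :=
    measure_mono_null (fun y hy => ⟨hy.1, (hy.2.trans hcb).le⟩ : Ioo a c ⊆ Ioc a b) h0
  rw [h.right_eq, withDensity_apply_eq_zero h.measurable_g.ennreal_ofReal] at h1
  have h2 : volume (Ioo a c) = 0 := by
    refine measure_mono_null (t := {y | ENNReal.ofReal (g y) ≠ 0} ∩ Ioo a c)
      (fun y hy => ⟨?_, hy⟩) h1
    have hy2 : (y : EReal) < rightEnd ν :=
      lt_of_lt_of_le (by exact_mod_cast hy.2) (hc.le.trans (min_le_right _ _))
    simpa using hgpos y (hla.trans (by exact_mod_cast hy.1)) hy2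
  rw [Real.volume_Ioo, ENNReal.ofReal_eq_zero] at h2
  have : a < c := by exact_mod_cast hac
  linarith

end Crossing

/-- The assumption compares the outer densities only inside `(ℓ_ν, r_ν)`; since `f` vanishes almost
everywhere off `(ℓ_μ, r_μ)`, the weak inequalities extend to the line. -/
lemma Dispersion.exists_crossing {μ ν : Measure ℝ} (h : Dispersion μ ν) :
    ∃ f g m m', Crossing μ ν f g m m' ∧ m' < rightEnd μ ∧
      (∀ y : ℝ, leftEnd ν < y → y < rightEnd ν → 0 < g y) ∧
      (∀ y : ℝ, leftEnd ν < y → y < m → f y < g y) := by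
  obtain ⟨f, g, hf, hg, hf0, hg0, hμ, hν, -, hgpos, hll, -, hrr, m, m', -, hmm, hm', hmid, hleft,
    hright, hm1, hm2⟩ := h
  have hac : NullSingletonClass μ := ⟨fun x => by
    rw [hμ]; exact withDensity_absolutelyContinuous _ _ (measure_singleton x)⟩
  have hsupp : ∀ᵐ y : ℝ, f y ≠ 0 → leftEnd μ < y ∧ (y : EReal) < rightEnd μ := by
    have h1 : ∀ᵐ y : ℝ ∂μ, leftEnd μ < y ∧ (y : EReal) < rightEnd μ :=
      (ae_leftEnd_lt μ).and (ae_lt_rightEnd μ)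
    -- The end points also mention `μ` and must be shielded from the rewriting of `μ` as a density.
    generalize leftEnd μ = l at h1 ⊢
    generalize rightEnd μ = r at h1 ⊢
    rw [hμ, ae_withDensity_iff hf.ennreal_ofReal] at h1
    filter_upwards [h1] with y hy hfy
    exact hy (by simpa using lt_of_le_of_ne (hf0 y) hfy.symm)
  refine ⟨f, g, m, m', ⟨hf, hg, hf0, hg0, hμ, hν, by exact_mod_cast hmm, ?_, ?_, ?_⟩, hm', hgpos,
    hleft⟩
  · intro y hy
    rcases hy.1.eq_or_lt with rfl | h1
    · exact hm1.ge
    rcases hy.2.eq_or_lt with rfl | h2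
    · exact hm2.ge
    exact (hmid y h1 h2).le
  · filter_upwards [hsupp] with y hy hym
    by_cases hfy : f y = 0
    · rw [hfy]; exact hg0 y
    · exact (hleft y (hll.trans_lt (hy hfy).1) hym).le
  · filter_upwards [hsupp] with y hy hym
    by_cases hfy : f y = 0
    · rw [hfy]; exact hg0 y
    · exact (hright y hym ((hy hfy).2.trans_le hrr)).le

/-! ### The threshold `xOne` -/

section XOne

variable {μ ν : Measure ℝ}

lemma gap_ne_zero_of_lt_xOne (hne : {x : ℝ | gap μ ν x = 0}.Nonempty) {x : ℝ}
    (hx : (x : EReal) < xOne μ ν) : gap μ ν x ≠ 0 := by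
  intro h0
  rw [xOne, if_pos hne] at hx
  exact (sInf_le (mem_image_of_mem _ h0) : sInf _ ≤ (x : EReal)).not_gt hx

variable [IsFiniteMeasure μ] [IsFiniteMeasure ν]

lemma exists_call_lt_of_lt_xOne (hμ : Integrable (fun x : ℝ => x) μ)
    (hν : Integrable (fun x : ℝ => x) ν) (hne : {x : ℝ | gap μ ν x = 0}.Nonempty) {x : ℝ}
    (hx : (x : EReal) < xOne μ ν) : ∃ k, callFun ν k < callFun (μ.restrict (Ici x)) k := by
  have h := gap_ne_zero_of_lt_xOne hne hx
  rw [Ne, gap_eq_zero_iff hμ hν] at h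
  push Not at h
  exact h

lemma call_le_of_xOne_lt (hμ : Integrable (fun x : ℝ => x) μ)
    (hν : Integrable (fun x : ℝ => x) ν) (hne : {x : ℝ | gap μ ν x = 0}.Nonempty) {x : ℝ}
    (hx : xOne μ ν < x) (k : ℝ) : callFun (μ.restrict (Ici x)) k ≤ callFun ν k := by
  rw [xOne, if_pos hne] at hx
  obtain ⟨_, ⟨z, hz, rfl⟩, hzx⟩ := sInf_lt_iff.1 hx
  have hzx' : z ≤ x := by exact_mod_cast hzx.le
  refine le_trans ?_ ((gap_eq_zero_iff hμ hν z).1 hz k)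
  exact setIntegral_mono_set (integrable_call hμ k).integrableOn
    (ae_of_all _ fun _ => le_max_right _ _) (Ici_subset_Ici.2 hzx').eventuallyLE

/-- The infimum defining `xOne` is attained: approach from the right and use that `μ` has no atom
there. -/
lemma call_le_of_xOne_eq [NullSingletonClass μ] (hμ : Integrable (fun x : ℝ => x) μ)
    (hν : Integrable (fun x : ℝ => x) ν) (hne : {x : ℝ | gap μ ν x = 0}.Nonempty) {x : ℝ}
    (hx : xOne μ ν = x) (k : ℝ) : callFun (μ.restrict (Ici x)) k ≤ callFun ν k := by
  obtain ⟨u, hu, hux, hut⟩ := exists_seq_strictAnti_tendsto x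
  have hU : ⋃ n, Ici (u n) = Ioi x := by
    ext y
    simp only [mem_iUnion, mem_Ici, mem_Ioi]
    refine ⟨fun ⟨n, hn⟩ => (hux n).trans_le hn, fun hy => ?_⟩
    obtain ⟨n, hn⟩ := (hut.eventually_lt_const hy).exists
    exact ⟨n, hn.le⟩
  have ht := tendsto_setIntegral_of_monotone (μ := μ) (f := fun y => max (y - k) 0)
    (s := fun n => Ici (u n)) (fun _ => measurableSet_Ici)
    (fun i j hij => Ici_subset_Ici.2 (hu.antitone hij)) (integrable_call hμ k).integrableOn
  rw [hU, ← integral_Ici_eq_integral_Ioi] at ht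
  exact le_of_tendsto' ht fun n =>
    call_le_of_xOne_lt hμ hν hne (hx ▸ by exact_mod_cast hux n) k

/-- If all calls on upper parts of `μ` are dominated, then so is the mean. -/
lemma integral_le_of_xOne_eq_bot (hμ : Integrable (fun x : ℝ => x) μ)
    (hν : Integrable (fun x : ℝ => x) ν) (hmass : ν.real univ = μ.real univ)
    (hne : {x : ℝ | gap μ ν x = 0}.Nonempty)
    (hx : xOne μ ν = ⊥) : ∫ y, y ∂μ ≤ ∫ y, y ∂ν := by
  have hle : ∀ k : ℝ, ∫ y, y ∂μ ≤ ∫ y, max y k ∂ν := by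
    -- Truncating at the strike `k` itself is invisible to the call, so the full call on `μ` is
    -- bounded; then `k` tends to `-∞`.
    intro k
    have h1 := call_le_of_xOne_lt hμ hν hne (x := k) (hx ▸ EReal.bot_lt_coe k) k
    have h2 : callFun (μ.restrict (Ici k)) k = ∫ y, max (y - k) 0 ∂μ := by
      refine setIntegral_eq_integral_of_forall_compl_eq_zero fun y hy => ?_
      exact max_eq_right (by simp at hy; linarith)
    have h3 : ∫ y, (y - k) ∂μ ≤ ∫ y, max (y - k) 0 ∂μ :=
      integral_mono (hμ.sub (integrable_const k)) (integrable_call hμ k) fun y => le_max_left _ _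
    rw [integral_sub hμ (integrable_const k)] at h3
    have h4 : ∫ y, max y k ∂ν = callFun ν k + ν.real univ * k := by
      have : (fun y : ℝ => max y k) = fun y => max (y - k) 0 + k := by
        ext y; rw [← max_add_add_right]; simp
      rw [this, integral_add (integrable_call hν k) (integrable_const k)]
      simp [callFun]
    simp only [integral_const, smul_eq_mul] at h3
    rw [h4, hmass]
    linarith
  have ht : Tendsto (fun k : ℝ => ∫ y, max y k ∂ν) atBot (𝓝 (∫ y, y ∂ν)) := by
    refine tendsto_integral_filter_of_dominated_convergence (fun x => |x|)
      (Eventually.of_forall fun k => (hν.1.aemeasurable.max aemeasurable_const).aestronglyMeasurable)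
      ?_ hν.abs ?_
    · filter_upwards [eventually_le_atBot 0] with k hk
      refine ae_of_all _ fun y => abs_le.2 ⟨?_, ?_⟩
      · exact (neg_abs_le y).trans (le_max_left _ _)
      · exact max_le (le_abs_self y) (hk.trans (abs_nonneg y))
    · refine ae_of_all _ fun y => tendsto_const_nhds.congr' ?_
      filter_upwards [eventually_le_atBot y] with k hk
      exact (max_eq_left hk).symm
  exact ge_of_tendsto' ht hle

end XOne

/-! ### Couplings -/

/-- The forward implication reads off the support of the image. The mass sent into `[q, ∞)` from
`[x, ∞)` already exhausts `ν[q, ∞)`, which gives the converse. -/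
lemma ae_le_iff_of_restrict_snd_eq {ν : Measure ℝ} [IsFiniteMeasure ν] {P : Measure (ℝ × ℝ)}
    (hsnd : P.snd = ν) {x q : ℝ}
    (h : (P.restrict (Prod.fst ⁻¹' Ici x)).snd = ν.restrict (Ici q)) :
    ∀ᵐ p ∂P, x ≤ p.1 ↔ q ≤ p.2 := by
  have hmx : MeasurableSet (Prod.fst ⁻¹' Ici x : Set (ℝ × ℝ)) := measurable_fst measurableSet_Ici
  have hmq : MeasurableSet (Prod.snd ⁻¹' Ici q : Set (ℝ × ℝ)) := measurable_snd measurableSet_Ici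
  have h1 : ∀ᵐ p ∂P, x ≤ p.1 → q ≤ p.2 := by
    have : ∀ᵐ y ∂(P.restrict (Prod.fst ⁻¹' Ici x)).snd, q ≤ y := by
      rw [h]; exact ae_restrict_mem measurableSet_Ici
    have := ae_of_ae_map measurable_snd.aemeasurable this
    exact (ae_restrict_iff' hmx).1 this
  have h2 : P (Prod.snd ⁻¹' Ici q \ Prod.fst ⁻¹' Ici x) = 0 := by
    have e1 : P (Prod.snd ⁻¹' Ici q) = ν (Ici q) := by
      rw [← hsnd, Measure.snd_apply measurableSet_Ici]
    have e2 : P (Prod.snd ⁻¹' Ici q ∩ Prod.fst ⁻¹' Ici x) = ν (Ici q) := by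
      rw [← Measure.restrict_apply hmq, ← Measure.snd_apply measurableSet_Ici, h,
        Measure.restrict_apply_self]
    have e3 := measure_inter_add_sdiff (μ := P) (Prod.snd ⁻¹' Ici q) hmx
    rw [e1, e2] at e3
    exact (ENNReal.add_right_inj (measure_ne_top ν (Ici q))).1 (e3.trans (add_zero _).symm)
  rw [measure_eq_zero_iff_ae_notMem] at h2
  filter_upwards [h1, h2] with p hp1 hp2
  refine ⟨hp1, fun hq => ?_⟩
  by_contra hx
  exact hp2 ⟨hq, hx⟩

namespace IsSupermartingaleCoupling

variable {μ ν : Measure ℝ} {P : Measure (ℝ × ℝ)}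

lemma isProbabilityMeasure [IsProbabilityMeasure μ] (h : IsSupermartingaleCoupling μ ν P) :
    IsProbabilityMeasure P :=
  ⟨by rw [← Measure.fst_univ, h.fst_eq, measure_univ]⟩

lemma ae_fst (h : IsSupermartingaleCoupling μ ν P) {p : ℝ → Prop} (hp : ∀ᵐ x ∂μ, p x) :
    ∀ᵐ z ∂P, p z.1 :=
  ae_of_ae_map measurable_fst.aemeasurable (show ∀ᵐ x ∂P.fst, p x from h.fst_eq ▸ hp)

lemma ae_snd (h : IsSupermartingaleCoupling μ ν P) {p : ℝ → Prop} (hp : ∀ᵐ x ∂ν, p x) :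
    ∀ᵐ z ∂P, p z.2 :=
  ae_of_ae_map measurable_snd.aemeasurable (show ∀ᵐ x ∂P.snd, p x from h.snd_eq ▸ hp)

lemma integrable_fst (h : IsSupermartingaleCoupling μ ν P)
    (hμ : Integrable (fun x : ℝ => x) μ) : Integrable (fun p : ℝ × ℝ => p.1) P := by
  rw [← h.fst_eq] at hμ
  exact hμ.comp_measurable measurable_fst

lemma integrable_snd (h : IsSupermartingaleCoupling μ ν P)
    (hν : Integrable (fun x : ℝ => x) ν) : Integrable (fun p : ℝ × ℝ => p.2) P := by
  rw [← h.snd_eq] at hν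
  exact hν.comp_measurable measurable_snd

lemma setIntegral_sub_condMean [IsProbabilityMeasure μ] (h : IsSupermartingaleCoupling μ ν P)
    (hμ : Integrable (fun x : ℝ => x) μ) (hν : Integrable (fun x : ℝ => x) ν) {B : Set (ℝ × ℝ)}
    (hB : MeasurableSet[MeasurableSpace.comap (Prod.fst : ℝ × ℝ → ℝ) inferInstance] B) :
    ∫ p in B, (p.1 - condMean P p) ∂P = ∫ p in B, (p.1 - p.2) ∂P := by
  have := h.isProbabilityMeasure
  rw [condMean, integral_sub (h.integrable_fst hμ).integrableOn integrable_condExp.integrableOn,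
    integral_sub (h.integrable_fst hμ).integrableOn (h.integrable_snd hν).integrableOn]
  congr 1
  exact setIntegral_condExp measurable_fst.comap_le (h.integrable_snd hν) hB

/-- On a set where the mean does not drop, the conditional mean is the starting point. -/
lemma condMean_eq_of_integral_le [IsProbabilityMeasure μ] (h : IsSupermartingaleCoupling μ ν P)
    (hμ : Integrable (fun x : ℝ => x) μ) (hν : Integrable (fun x : ℝ => x) ν) {s : Set ℝ}
    (hs : MeasurableSet s) (hle : ∫ p in Prod.fst ⁻¹' s, (p.1 - p.2) ∂P ≤ 0) :
    ∀ᵐ p ∂P, p.1 ∈ s → condMean P p = p.1 := by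
  have := h.isProbabilityMeasure
  have hm : MeasurableSet (Prod.fst ⁻¹' s : Set (ℝ × ℝ)) := measurable_fst hs
  rw [← h.setIntegral_sub_condMean hμ hν ⟨s, hs, rfl⟩] at hle
  have hnn : ∀ᵐ p ∂P.restrict (Prod.fst ⁻¹' s), 0 ≤ p.1 - condMean P p := by
    filter_upwards [ae_restrict_of_ae h.condMean_le] with p hp
    linarith
  have h0 := le_antisymm hle (integral_nonneg_of_ae hnn)
  rw [setIntegral_eq_zero_iff_of_nonneg_ae hnn
    ((h.integrable_fst hμ).sub integrable_condExp).integrableOn] at h0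
  filter_upwards [(ae_restrict_iff' hm).1 h0] with p hp hps
  have := hp hps
  simp only [Pi.zero_apply] at this
  linarith

/-- Where the second coordinate lies strictly below the first one, so does the conditional mean. -/
lemma condMean_ne_of_ae_lt [IsProbabilityMeasure μ] (h : IsSupermartingaleCoupling μ ν P)
    (hμ : Integrable (fun x : ℝ => x) μ) (hν : Integrable (fun x : ℝ => x) ν) {s : Set ℝ}
    (hs : MeasurableSet s) (hlt : ∀ᵐ p ∂P, p.1 ∈ s → p.2 < p.1) :
    ∀ᵐ p ∂P, p.1 ∈ s → condMean P p ≠ p.1 := by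
  have := h.isProbabilityMeasure
  -- The martingale points over `s` form an event of the first coordinate, so there `X - Y`
  -- integrates to zero although it is positive.
  have hB : MeasurableSet[MeasurableSpace.comap (Prod.fst : ℝ × ℝ → ℝ) inferInstance]
      (Prod.fst ⁻¹' s ∩ {p | condMean P p = p.1}) := by
    refine @MeasurableSet.inter _ (MeasurableSpace.comap _ _) _ _ ⟨s, hs, rfl⟩ ?_
    exact measurableSet_eq_fun stronglyMeasurable_condExp.measurable (comap_measurable _)
  have hB' : MeasurableSet (Prod.fst ⁻¹' s ∩ {p | condMean P p = p.1}) :=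
    measurable_fst.comap_le _ hB
  have h0 := h.setIntegral_sub_condMean hμ hν hB
  rw [setIntegral_eq_zero_of_forall_eq_zero
    (fun p hp => sub_eq_zero.2 (Eq.symm hp.2))] at h0
  have hpos : ∀ᵐ p ∂P.restrict (Prod.fst ⁻¹' s ∩ {p | condMean P p = p.1}), 0 < p.1 - p.2 := by
    filter_upwards [ae_restrict_of_ae hlt, ae_restrict_mem hB'] with p hp hpB
    linarith [hp hpB.1]
  have hnn := hpos.mono fun p hp => hp.le
  have h1 := (setIntegral_eq_zero_iff_of_nonneg_ae hnn
    ((h.integrable_fst hμ).sub (h.integrable_snd hν)).integrableOn).1 h0.symm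
  have h2 : ∀ᵐ p ∂P.restrict (Prod.fst ⁻¹' s ∩ {p | condMean P p = p.1}), False := by
    filter_upwards [hpos, h1] with p hp1 hp2
    exact hp1.ne' hp2
  filter_upwards [(ae_restrict_iff' hB').1 h2] with p hp hps hc
  exact hp ⟨hps, hc⟩

end IsSupermartingaleCoupling

/-! ### The quantile map -/

lemma ae_rightInvCdf_cdf {ν : Measure ℝ} [IsProbabilityMeasure ν] [NullSingletonClass ν]
    (hstrict : ∀ a b : ℝ, leftEnd ν < a → a < rightEnd ν → a < b → cdf ν a < cdf ν b) :
    ∀ᵐ y ∂ν, rightInvCdf ν (cdf ν y) = y := by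
  filter_upwards [ae_leftEnd_lt ν, ae_lt_rightEnd ν] with y hl hr
  have : {z | cdf ν y < cdf ν z} = Ioi y := by
    ext z
    exact ⟨fun hz => lt_of_not_ge fun hzy => (monotone_cdf ν hzy).not_gt hz,
      fun hz => hstrict y z hl hr hz⟩
  rw [rightInvCdf, this, csInf_Ioi]

lemma monotoneOn_rightInvCdf (ν : Measure ℝ) : MonotoneOn (rightInvCdf ν) (Ioo 0 1) := by
  intro s hs t ht hst
  refine csInf_le_csInf ?_ ((tendsto_cdf_atTop ν).eventually_const_lt ht.2).exists
    fun y hy => hst.trans_lt hy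
  obtain ⟨b, hb⟩ := ((tendsto_cdf_atBot ν).eventually_lt_const hs.1).exists
  exact ⟨b, fun y hy => le_of_not_gt fun hyb => (hb.trans hy).not_ge (monotone_cdf ν hyb.le)⟩

/-- At levels 0 and 1 the real `sInf` may take its default value and break monotonicity, but `F_μ`
lies in `(0, 1)` almost everywhere. -/
lemma aemeasurable_quantileMap (μ ν : Measure ℝ) [IsProbabilityMeasure μ] [NullSingletonClass μ] :
    AEMeasurable (fun x => rightInvCdf ν (cdf μ x)) μ := by
  have hs : MeasurableSet {x | cdf μ x ∈ Ioo (0 : ℝ) 1} :=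
    (monotone_cdf μ).measurable measurableSet_Ioo
  have hae : ∀ᵐ x ∂μ, x ∈ {x | cdf μ x ∈ Ioo (0 : ℝ) 1} := by
    filter_upwards [ae_leftEnd_lt μ, ae_lt_rightEnd μ] with x hl hr
    exact ⟨cdf_pos_of_leftEnd_lt hl, cdf_lt_one_of_lt_rightEnd hr⟩
  have h := aemeasurable_restrict_of_monotoneOn (μ := μ) (f := fun x => rightInvCdf ν (cdf μ x))
    hs fun x hx y hy hxy => monotoneOn_rightInvCdf ν hx hy (monotone_cdf μ hxy)
  rwa [Measure.restrict_eq_self_of_ae_mem hae] at h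

/-- A coupling concentrated on the graph of the quantile map over `s` is the quantile coupling
there. -/
lemma restrict_eq_quantileCoupling {μ ν : Measure ℝ} [IsProbabilityMeasure μ]
    [NullSingletonClass μ] {P : Measure (ℝ × ℝ)} (hfst : P.fst = μ) {s : Set ℝ}
    (hs : MeasurableSet s) (h : ∀ᵐ p ∂P, p.1 ∈ s → p.2 = rightInvCdf ν (cdf μ p.1)) :
    P.restrict (Prod.fst ⁻¹' s) = (quantileCoupling μ ν).restrict (Prod.fst ⁻¹' s) := by
  have hm : MeasurableSet (Prod.fst ⁻¹' s : Set (ℝ × ℝ)) := measurable_fst hs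
  have hT : AEMeasurable (fun x => (x, rightInvCdf ν (cdf μ x))) μ :=
    aemeasurable_id.prodMk (aemeasurable_quantileMap μ ν)
  have h1 : P.restrict (Prod.fst ⁻¹' s) =
      (P.restrict (Prod.fst ⁻¹' s)).map fun p => (p.1, rightInvCdf ν (cdf μ p.1)) := by
    conv_lhs => rw [← Measure.map_id (μ := P.restrict (Prod.fst ⁻¹' s))]
    refine Measure.map_congr ?_
    filter_upwards [(ae_restrict_iff' hm).2 h] with p hp
    exact Prod.ext rfl hp
  have h2 : (P.restrict (Prod.fst ⁻¹' s)).map Prod.fst = μ.restrict s := by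
    rw [← hfst, Measure.fst, Measure.restrict_map measurable_fst hs]
  have h3 : (quantileCoupling μ ν).restrict (Prod.fst ⁻¹' s) =
      (μ.restrict s).map fun x => (x, rightInvCdf ν (cdf μ x)) := by
    rw [quantileCoupling, Measure.restrict_map_of_aemeasurable hT hm]
    rfl
  rw [h1, h3, ← h2, AEMeasurable.map_map_of_aemeasurable (h2 ▸ hT.restrict)
    measurable_fst.aemeasurable]
  rfl

/-! ### The decreasing coupling on both sides of the threshold -/

namespace Crossing

variable {μ ν : Measure ℝ} {f g : ℝ → ℝ} {m m' : ℝ} [IsProbabilityMeasure μ]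
  [IsProbabilityMeasure ν]

/-- The point `m'` is a witness, so the convention for `inf ∅` never enters. -/
lemma nonempty_gap_eq_zero (h : Crossing μ ν f g m m') (hμ : Integrable (fun x : ℝ => x) μ)
    (hν : Integrable (fun x : ℝ => x) ν) : {x : ℝ | gap μ ν x = 0}.Nonempty :=
  ⟨m', (gap_eq_zero_iff hμ hν m').2
    (h.call_le_of_cdf_le hμ hν h.lt.le (h.cdf_right_le le_rfl))⟩

lemma cdf_lt_of_le_of_lt_xOne (h : Crossing μ ν f g m m') (hμ : Integrable (fun x : ℝ => x) μ)
    (hν : Integrable (fun x : ℝ => x) ν) {x : ℝ} (hx : (x : EReal) < xOne μ ν) (hm : m ≤ x) :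
    cdf μ x < cdf ν x := by
  by_contra! hle
  exact gap_ne_zero_of_lt_xOne (h.nonempty_gap_eq_zero hμ hν) hx
    ((gap_eq_zero_iff hμ hν x).2 (h.call_le_of_cdf_le hμ hν hm hle))

lemma lt_of_lt_xOne (h : Crossing μ ν f g m m') (hμ : Integrable (fun x : ℝ => x) μ)
    (hν : Integrable (fun x : ℝ => x) ν) {x : ℝ} (hx : (x : EReal) < xOne μ ν) : x < m' := by
  by_contra! hle
  exact (h.cdf_lt_of_le_of_lt_xOne hμ hν hx (h.lt.le.trans hle)).not_ge (h.cdf_right_le hle)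

lemma xOne_le (h : Crossing μ ν f g m m') (hμ : Integrable (fun x : ℝ => x) μ)
    (hν : Integrable (fun x : ℝ => x) ν) : xOne μ ν ≤ m' :=
  le_of_not_gt fun hlt => (h.lt_of_lt_xOne hμ hν hlt).false

/-- Left of `m` the densities decide; right of `m` the reverse inequality would make the gap vanish.
This puts `q` at or below `x`, and later `Y` below `X`. -/
lemma cdf_lt_of_lt_xOne (h : Crossing μ ν f g m m') (hμ : Integrable (fun x : ℝ => x) μ)
    (hν : Integrable (fun x : ℝ => x) ν)
    (hlt : ∀ y : ℝ, leftEnd ν < y → y < m → f y < g y) {x : ℝ} (hx : (x : EReal) < xOne μ ν)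
    (hpos : 0 < cdf μ x) : cdf μ x < cdf ν x := by
  rcases le_total x m with hm | hm
  · exact h.cdf_lt_of_lt hlt hm hpos
  · exact h.cdf_lt_of_le_of_lt_xOne hμ hν hx hm

/-- Below `xOne`, the coupling transports upper parts of `μ` to upper parts of `ν`. -/
lemma exists_snd_eq (h : Crossing μ ν f g m m') (hμ : Integrable (fun x : ℝ => x) μ)
    (hν : Integrable (fun x : ℝ => x) ν)
    (hlt : ∀ y : ℝ, leftEnd ν < y → y < m → f y < g y) (hm' : m' < rightEnd μ)
    {P : Measure (ℝ × ℝ)} (hP : IsDecreasingCoupling μ ν P) {x : ℝ}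
    (hx : (x : EReal) < xOne μ ν) (hpos : 0 < cdf μ x) :
    ∃ q, cdf ν q = cdf μ x ∧ (∀ y, cdf μ x ≤ cdf ν y ↔ q ≤ y) ∧
      (P.restrict (Prod.fst ⁻¹' Ici x)).snd = ν.restrict (Ici q) := by
  have := h.nullSingletonClass_left
  have := h.nullSingletonClass_right
  have hxm := h.lt_of_lt_xOne hμ hν hx
  have h1 : cdf μ x < 1 :=
    cdf_lt_one_of_lt_rightEnd (lt_trans (by exact_mod_cast hxm) hm')
  obtain ⟨q, hq, hiff⟩ := exists_quantile ν hpos h1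
  have hqx : q ≤ x := (hiff x).1 (h.cdf_lt_of_lt_xOne hμ hν hlt hx hpos).le
  obtain ⟨k, hk⟩ := exists_call_lt_of_lt_xOne hμ hν (h.nonempty_gap_eq_zero hμ hν) hx
  exact ⟨q, hq, hiff, (hP.isShadow x).eq_restrict_Ici (h.convexDecLE_tail hμ hν hqx hxm
    (by rw [measureReal_Ici, measureReal_Ici, hq]) hk)⟩

/-- Phrased through ranks so as to include `F_μ(x) = 0`, where a finite quantile need not exist. -/
lemma ae_cdf_compare (h : Crossing μ ν f g m m') (hμ : Integrable (fun x : ℝ => x) μ)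
    (hν : Integrable (fun x : ℝ => x) ν)
    (hlt : ∀ y : ℝ, leftEnd ν < y → y < m → f y < g y) (hm' : m' < rightEnd μ)
    {P : Measure (ℝ × ℝ)} (hP : IsDecreasingCoupling μ ν P) {x : ℝ}
    (hx : (x : EReal) < xOne μ ν) :
    ∀ᵐ p ∂P, (x ≤ p.1 → cdf μ x ≤ cdf ν p.2) ∧ (p.1 < x → cdf ν p.2 ≤ cdf μ x) := by
  rcases (cdf_nonneg μ x).eq_or_lt with h0 | hpos
  · have hnull : ∀ᵐ y ∂μ, ¬ y < x := by
      have h1 : μ (Iic x) = 0 := by rw [← ofReal_cdf, ← h0, ENNReal.ofReal_zero]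
      rw [measure_eq_zero_iff_ae_notMem] at h1
      filter_upwards [h1] with y hy hyx
      exact hy hyx.le
    filter_upwards [hP.ae_fst hnull] with p hp
    exact ⟨fun _ => h0 ▸ cdf_nonneg ν _, fun h2 => absurd h2 hp⟩
  · obtain ⟨q, hq, hiff, hsnd⟩ := h.exists_snd_eq hμ hν hlt hm' hP hx hpos
    filter_upwards [ae_le_iff_of_restrict_snd_eq hP.snd_eq hsnd] with p hp
    refine ⟨fun h1 => (hiff _).2 (hp.1 h1), fun h1 => ?_⟩
    rw [← hq]
    exact monotone_cdf ν (le_of_not_ge fun h2 => h1.not_ge (hp.2 h2))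

/-- Below `xOne`, the two coordinates have the same rank. -/
lemma ae_cdf_eq (h : Crossing μ ν f g m m') (hμ : Integrable (fun x : ℝ => x) μ)
    (hν : Integrable (fun x : ℝ => x) ν)
    (hlt : ∀ y : ℝ, leftEnd ν < y → y < m → f y < g y) (hm' : m' < rightEnd μ)
    {P : Measure (ℝ × ℝ)} (hP : IsDecreasingCoupling μ ν P) :
    ∀ᵐ p ∂P, (∀ z : ℝ, z < p.1 → (z : EReal) < xOne μ ν → cdf μ z ≤ cdf ν p.2) ∧
      ((p.1 : EReal) < xOne μ ν → cdf ν p.2 = cdf μ p.1) := by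
  have := h.nullSingletonClass_left
  -- Rational thresholds keep the exceptional set null; continuity of `F_μ` recovers the rank
  -- itself.
  have hall : ∀ᵐ p ∂P, ∀ r : ℚ, (((r : ℝ) : EReal) < xOne μ ν →
      ((r : ℝ) ≤ p.1 → cdf μ r ≤ cdf ν p.2) ∧ (p.1 < (r : ℝ) → cdf ν p.2 ≤ cdf μ r)) := by
    refine ae_all_iff.2 fun r => ?_
    by_cases hr : ((r : ℝ) : EReal) < xOne μ ν
    · filter_upwards [h.ae_cdf_compare hμ hν hlt hm' hP hr] with p hp _ using hp
    · exact ae_of_all _ fun p hr' => absurd hr' hr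
  filter_upwards [hall] with p hp
  have hlow : ∀ z : ℝ, z < p.1 → (z : EReal) < xOne μ ν → cdf μ z ≤ cdf ν p.2 := by
    intro z hz hz1
    obtain ⟨c, hzc, hc⟩ := EReal.lt_iff_exists_real_btwn.1 hz1
    obtain ⟨r, hr1, hr2⟩ := exists_rat_btwn (lt_min hz (EReal.coe_lt_coe_iff.1 hzc))
    have hrc : ((r : ℝ) : EReal) < xOne μ ν :=
      lt_trans (by exact_mod_cast hr2.trans_le (min_le_right _ _)) hc
    exact (monotone_cdf μ hr1.le).trans ((hp r hrc).1 (hr2.le.trans (min_le_left _ _)))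
  refine ⟨hlow, fun hp1 => le_antisymm ?_ ?_⟩
  · obtain ⟨c, hpc, hc⟩ := EReal.lt_iff_exists_real_btwn.1 hp1
    have hpc' : p.1 < c := by exact_mod_cast hpc
    refine ge_of_tendsto ((continuous_cdf μ).continuousAt.mono_left
      (nhdsWithin_le_nhds (s := Ioi p.1))) ?_
    filter_upwards [Ioo_mem_nhdsGT hpc'] with z hz
    obtain ⟨r, hr1, hr2⟩ := exists_rat_btwn hz.1
    have hrc : ((r : ℝ) : EReal) < xOne μ ν := lt_trans (by exact_mod_cast hr2.trans hz.2) hc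
    exact ((hp r hrc).2 hr1).trans (monotone_cdf μ hr2.le)
  · refine le_of_tendsto ((continuous_cdf μ).continuousAt.mono_left
      (nhdsWithin_le_nhds (s := Iio p.1))) ?_
    filter_upwards [self_mem_nhdsWithin] with z hz
    exact hlow z hz (lt_trans (by exact_mod_cast hz) hp1)

/-- With no mass to the left of `x₁`, the gap would already vanish at `x₁ - 1`. -/
lemma cdf_pos_of_xOne_eq (h : Crossing μ ν f g m m') (hμ : Integrable (fun x : ℝ => x) μ)
    (hν : Integrable (fun x : ℝ => x) ν) {x : ℝ} (hx : xOne μ ν = x) : 0 < cdf μ x := by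
  have := h.nullSingletonClass_left
  refine lt_of_le_of_ne (cdf_nonneg μ x) fun h0 => ?_
  have hnull : μ (Iic x) = 0 := by rw [← ofReal_cdf, ← h0, ENNReal.ofReal_zero]
  rw [measure_eq_zero_iff_ae_notMem] at hnull
  have hne := h.nonempty_gap_eq_zero hμ hν
  obtain ⟨k, hk⟩ := exists_call_lt_of_lt_xOne hμ hν hne (x := x - 1)
    (by rw [hx]; exact_mod_cast sub_one_lt x)
  have heq : μ.restrict (Ici (x - 1)) = μ.restrict (Ici x) := by
    refine Measure.restrict_congr_set ?_
    filter_upwards [hnull] with y hy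
    have hy' : x < y := not_le.1 hy
    exact propext ⟨fun _ => hy'.le, fun _ => ((sub_one_lt x).trans hy').le⟩
  rw [heq] at hk
  exact hk.not_ge (call_le_of_xOne_eq hμ hν hne hx k)

/-- At a finite `xOne`, the coupling transports `μ|[xOne, ∞)` to an upper part of `ν` with the
same mean. -/
lemma snd_eq_of_xOne_eq (h : Crossing μ ν f g m m') (hμ : Integrable (fun x : ℝ => x) μ)
    (hν : Integrable (fun x : ℝ => x) ν)
    (hlt : ∀ y : ℝ, leftEnd ν < y → y < m → f y < g y) (hm' : m' < rightEnd μ)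
    {P : Measure (ℝ × ℝ)} (hP : IsDecreasingCoupling μ ν P) {x : ℝ} (hx : xOne μ ν = x) :
    ∃ q, (P.restrict (Prod.fst ⁻¹' Ici x)).snd = ν.restrict (Ici q) ∧
      ∫ p in Prod.fst ⁻¹' Ici x, (p.1 - p.2) ∂P ≤ 0 := by
  have := h.nullSingletonClass_left
  have := h.nullSingletonClass_right
  have hmx : MeasurableSet (Prod.fst ⁻¹' Ici x : Set (ℝ × ℝ)) := measurable_fst measurableSet_Ici
  have hxm : x ≤ m' := by
    have := h.xOne_le hμ hν
    rw [hx] at this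
    exact_mod_cast this
  have h1 : cdf μ x < 1 :=
    cdf_lt_one_of_lt_rightEnd (lt_of_le_of_lt (by exact_mod_cast hxm) hm')
  obtain ⟨q, hq, hiff⟩ := exists_quantile ν (h.cdf_pos_of_xOne_eq hμ hν hx) h1
  have hmass : ν.real (Ici q) = μ.real (Ici x) := by rw [measureReal_Ici, measureReal_Ici, hq]
  -- At `x₁` no call is strictly dearer on `μ`, so the tail is found from the rank bounds at `z <
  -- x₁` as `z` increases to `x₁`.
  have hae : ∀ᵐ y ∂(P.restrict (Prod.fst ⁻¹' Ici x)).snd, y ∈ Ici q := by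
    refine (ae_map_iff measurable_snd.aemeasurable measurableSet_Ici).2 ?_
    filter_upwards [ae_restrict_of_ae (h.ae_cdf_eq hμ hν hlt hm' hP), ae_restrict_mem hmx]
      with p hp hpx
    refine (hiff _).1 (le_of_tendsto ((continuous_cdf μ).continuousAt.mono_left
      (nhdsWithin_le_nhds (s := Iio x))) ?_)
    filter_upwards [self_mem_nhdsWithin] with z hz
    exact hp.1 z (lt_of_lt_of_le hz hpx) (hx ▸ by exact_mod_cast hz)
  have hfst : (P.restrict (Prod.fst ⁻¹' Ici x)).map Prod.fst = μ.restrict (Ici x) := by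
    rw [← hP.fst_eq, Measure.fst, Measure.restrict_map measurable_fst measurableSet_Ici]
  have hsnd : (P.restrict (Prod.fst ⁻¹' Ici x)).snd = ν.restrict (Ici q) := by
    refine measure_eq_of_le_of_univ_le ?_ ?_
    · rw [← Measure.restrict_eq_self_of_ae_mem hae]
      exact Measure.restrict_mono le_rfl (hP.isShadow x).le
    · rw [Measure.snd_univ, ← Measure.fst_univ, Measure.fst, hfst]
      simp only [Measure.restrict_apply_univ]
      exact ((measureReal_eq_measureReal_iff).1 hmass).le
  refine ⟨q, hsnd, ?_⟩
  have hmeas : Measurable fun y : ℝ => y := measurable_id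
  have hi1 : ∫ p in Prod.fst ⁻¹' Ici x, p.1 ∂P = ∫ y in Ici x, y ∂μ := by
    rw [← hfst, integral_map measurable_fst.aemeasurable hmeas.aestronglyMeasurable]
  have hi2 : ∫ p in Prod.fst ⁻¹' Ici x, p.2 ∂P = ∫ y in Ici q, y ∂ν := by
    rw [← hsnd, Measure.snd, integral_map measurable_snd.aemeasurable hmeas.aestronglyMeasurable]
  rw [integral_sub (hP.integrable_fst hμ).integrableOn (hP.integrable_snd hν).integrableOn,
    hi1, hi2]
  -- At strike `q` the call on `ν` is linear on its tail; with equal masses the inequality becomes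
  -- one between means.
  have hcall := call_le_of_xOne_eq hμ hν (h.nonempty_gap_eq_zero hμ hν) hx q
  have h2 : ∫ y in Ici x, (y - q) ∂μ ≤ callFun (μ.restrict (Ici x)) q :=
    integral_mono (hμ.integrableOn.sub (integrable_const q)) (integrable_call hμ.integrableOn q)
      fun y => le_max_left _ _
  have h3 : callFun ν q = ∫ y in Ici q, (y - q) ∂ν := by
    rw [callFun, ← setIntegral_eq_integral_of_forall_compl_eq_zero (s := Ici q)]
    · refine setIntegral_congr_fun measurableSet_Ici fun y hy => ?_
      exact max_eq_left (sub_nonneg.2 hy)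
    · intro y hy
      exact max_eq_right (by simp at hy; linarith)
  rw [integral_sub hμ.integrableOn (integrable_const q)] at h2
  rw [integral_sub hν.integrableOn (integrable_const q)] at h3
  simp only [integral_const, MeasurableSet.univ, measureReal_restrict_apply, univ_inter,
    smul_eq_mul] at h2 h3
  rw [hmass] at h3
  linarith

/-- The part of `μ` above `xOne` is transported to an upper part of `ν` with the same mean,
which is its shadow. -/
lemma exists_snd_eq_xOne (h : Crossing μ ν f g m m') (hμ : Integrable (fun x : ℝ => x) μ)
    (hν : Integrable (fun x : ℝ => x) ν) (hcd : ConvexDecLE μ ν)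
    (hlt : ∀ y : ℝ, leftEnd ν < y → y < m → f y < g y) (hm' : m' < rightEnd μ)
    {P : Measure (ℝ × ℝ)} (hP : IsDecreasingCoupling μ ν P) :
    ∃ s : Set ℝ, IsClosed s ∧ IsUpperSet s ∧
      (P.restrict (Prod.fst ⁻¹' {x : ℝ | xOne μ ν ≤ x})).snd = ν.restrict s ∧
      shadow ν (μ.restrict {x : ℝ | xOne μ ν ≤ x}) = ν.restrict s ∧
      ∫ p in Prod.fst ⁻¹' {x : ℝ | xOne μ ν ≤ x}, (p.1 - p.2) ∂P ≤ 0 := by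
  have hle := h.xOne_le hμ hν
  induction hx : xOne μ ν with
  | bot =>
    have huniv : {x : ℝ | (⊥ : EReal) ≤ x} = univ := by simp
    refine ⟨univ, isClosed_univ, isUpperSet_univ, ?_, ?_, ?_⟩
    · rw [huniv, preimage_univ, Measure.restrict_univ, Measure.restrict_univ, hP.snd_eq]
    · rw [huniv, Measure.restrict_univ, Measure.restrict_univ]
      -- Equal total masses leave `ν` as the only competitor.
      have hfull : ∀ θ : Measure ℝ, ConvexDecLE μ θ → θ ≤ ν → θ = ν := fun θ h1 h2 => by
        have : IsFiniteMeasure θ := ⟨(h2 univ).trans_lt (measure_lt_top ν univ)⟩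
        refine measure_eq_of_le_of_univ_le h2 ?_
        rw [← h1.univ_eq, measure_univ, measure_univ]
      have hS : IsShadow ν μ ν :=
        ⟨hcd, le_rfl, fun θ h1 h2 => (hfull θ h1 h2).symm ▸ ConvexDecLE.refl ν⟩
      exact hfull _ (isShadow_shadow hS).convexDecLE (isShadow_shadow hS).le
    · rw [huniv, preimage_univ, Measure.restrict_univ,
        integral_sub (hP.integrable_fst hμ) (hP.integrable_snd hν)]
      have hmeas : Measurable fun y : ℝ => y := measurable_id
      have e1 : ∫ p, p.1 ∂P = ∫ y, y ∂μ := by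
        rw [← hP.fst_eq, Measure.fst,
          integral_map measurable_fst.aemeasurable hmeas.aestronglyMeasurable]
      have e2 : ∫ p, p.2 ∂P = ∫ y, y ∂ν := by
        rw [← hP.snd_eq, Measure.snd,
          integral_map measurable_snd.aemeasurable hmeas.aestronglyMeasurable]
      rw [e1, e2]
      exact sub_nonpos.2 (integral_le_of_xOne_eq_bot hμ hν (by simp)
        (h.nonempty_gap_eq_zero hμ hν) hx)
  | coe x =>
    have hset : {y : ℝ | (x : EReal) ≤ y} = Ici x := by ext y; simp
    obtain ⟨q, hq, hint⟩ := h.snd_eq_of_xOne_eq hμ hν hlt hm' hP hx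
    have hS := hP.isShadow x
    refine ⟨Ici q, isClosed_Ici, isUpperSet_Ici q, ?_, ?_, ?_⟩
    · rw [hset, hq]
    · rw [hset]
      exact (isShadow_shadow hS).eq_restrict_Ici (hq ▸ hS.convexDecLE)
    · rw [hset]
      exact hint
  | top =>
    rw [hx] at hle
    exact absurd (top_le_iff.1 hle) (EReal.coe_ne_top m')

end Crossing

lemma IsMartingalePointSet.ae_eq {P : Measure (ℝ × ℝ)} {M N : Set ℝ}
    (hM : IsMartingalePointSet P M) (hN : IsMartingalePointSet P N) : M =ᵐ[P.fst] N := by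
  have h : ∀ᵐ x ∂P.fst, x ∈ M ↔ x ∈ N := by
    refine (ae_map_iff measurable_fst.aemeasurable
      (MeasurableSet.iff hM.measurableSet hN.measurableSet)).2 ?_
    filter_upwards [hM.mem_iff, hN.mem_iff] with p h1 h2
    exact h1.trans h2.symm
  filter_upwards [h] with x hx using propext hx

end SMOT

theorem mainTheorem9 (μ ν : Measure ℝ) [IsProbabilityMeasure μ] [IsProbabilityMeasure ν]
    (hμ : Integrable (fun x : ℝ => x) μ) (hν : Integrable (fun y : ℝ => y) ν)
    (hcd : SMOT.ConvexDecLE μ ν) (hdisp : SMOT.Dispersion μ ν)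
    (P : Measure (ℝ × ℝ)) (hP : SMOT.IsDecreasingCoupling μ ν P) :
    -- the set of martingale points is `[x₁, r_μ)`, uniquely up to `μ`-null sets
    SMOT.IsMartingalePointSet P (SMOT.realIco (SMOT.xOne μ ν) (SMOT.rightEnd μ)) ∧
    (∀ M : Set ℝ, SMOT.IsMartingalePointSet P M →
      M =ᵐ[μ] SMOT.realIco (SMOT.xOne μ ν) (SMOT.rightEnd μ)) ∧
    -- the second marginal of the restriction of `P` to `[x₁, r_μ) × ℝ` is `ν|_{[y₁, r_ν)}`
    (P.restrict (Prod.fst ⁻¹' SMOT.realIco (SMOT.xOne μ ν) (SMOT.rightEnd μ))).snd =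
      ν.restrict (SMOT.realIco (SMOT.yOne μ ν) (SMOT.rightEnd ν)) ∧
    -- on `(-∞, x₁) × ℝ` the coupling is the quantile coupling
    P.restrict (Prod.fst ⁻¹' {x : ℝ | (x : EReal) < SMOT.xOne μ ν}) =
      (SMOT.quantileCoupling μ ν).restrict
        (Prod.fst ⁻¹' {x : ℝ | (x : EReal) < SMOT.xOne μ ν}) := by
  obtain ⟨f, g, m, m', h, hm', hgpos, hlt⟩ := hdisp.exists_crossing
  have := h.nullSingletonClass_left
  have := h.nullSingletonClass_right
  have hcdf := h.ae_cdf_eq hμ hν hlt hm' hP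
  obtain ⟨s, hs, hup, hsnd, hshadow, hint⟩ := h.exists_snd_eq_xOne hμ hν hcd hlt hm' hP
  have hA : MeasurableSet {x : ℝ | SMOT.xOne μ ν ≤ x} :=
    measurableSet_le measurable_const measurable_coe_real_ereal
  have hB : MeasurableSet {x : ℝ | (x : EReal) < SMOT.xOne μ ν} :=
    measurableSet_lt measurable_coe_real_ereal measurable_const
  have hright := hP.ae_fst (SMOT.ae_lt_rightEnd μ)
  -- Equal ranks together with `F_μ < F_ν` at `X` force `Y < X`.
  have hbelow : ∀ᵐ p ∂P, p.1 ∈ {x : ℝ | (x : EReal) < SMOT.xOne μ ν} → p.2 < p.1 := by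
    filter_upwards [hcdf, hP.ae_fst (SMOT.ae_leftEnd_lt μ)] with p hp hl hpx
    have h1 := h.cdf_lt_of_lt_xOne hμ hν hlt hpx (SMOT.cdf_pos_of_leftEnd_lt hl)
    rw [← hp.2 hpx] at h1
    exact lt_of_not_ge fun hle => (monotone_cdf ν hle).not_gt h1
  have hM : SMOT.IsMartingalePointSet P (SMOT.realIco (SMOT.xOne μ ν) (SMOT.rightEnd μ)) := by
    refine ⟨SMOT.measurableSet_realIco _ _, ?_⟩
    filter_upwards [hright, hP.condMean_eq_of_integral_le hμ hν hA hint,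
      hP.condMean_ne_of_ae_lt hμ hν hB hbelow] with p hr h1 h2
    exact ⟨fun hp => h1 hp.1, fun hp => ⟨le_of_not_gt fun hpx => h2 hpx hp, hr⟩⟩
  refine ⟨hM, fun M hM' => ?_, ?_, ?_⟩
  · have := hM'.ae_eq hM
    rwa [hP.fst_eq] at this
  · rw [SMOT.yOne, hshadow, SMOT.restrict_realIco_leftEnd ν hs hup, ← hsnd]
    congr 1
    refine Measure.restrict_congr_set ?_
    filter_upwards [hright] with p hr
    exact propext ⟨fun hp => hp.1, fun hp => ⟨hp, hr⟩⟩
  · refine SMOT.restrict_eq_quantileCoupling hP.fst_eq hB ?_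
    filter_upwards [hcdf, hP.ae_snd (SMOT.ae_rightInvCdf_cdf (h.cdf_strict hgpos))] with p hp hq hpx
    rw [← hp.2 hpx, hq]
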